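/- Let $d\ge 2$ be an integer, $\mathfrak b>1$ and $\theta>0$, and let $U:\mathbb R\to\mathbb R$ be three times continuously differentiable with $U''>0$ on $[1,\mathfrak b]$. For $\varepsilon,\sigma>0$ let $B^1,\dots,B^{d-1}$ be independent standard Brownian motions on a probability space. Let $\mathcal X=(\mathcal X^0,\dots,\mathcal X^d)$ and $Z=(Z^0,\dots,Z^d)$ be continuous processes on $[0,\infty)$ that are driven by these same Brownian motions and satisfy $$\mathcal X^i_0=Z^i_0=i\quad(0\le i\le d),\qquad \mathcal X^0_t=Z^0_t=0,\qquad \mathcal X^d_t=Z^d_t=d+\varepsilon t\quad (t\ge 0),$$ and, for $1\le i\le d-1$ and $t\ge0$, $$d\mathcal X^i_t=\bigl(U'(\mathcal X^{i+1}_t-\mathcal X^i_t)-U'(\mathcal X^i_t-\mathcal X^{i-1}_t)\bigr)\,dt+\sigma\,dB^i_t,$$ $$dZ^i_t=U''\Bigl(1+\frac{\varepsilon t}{d}\Bigr)\bigl(Z^{i+1}_t+Z^{i-1}_t-2Z^i_t\bigr)\,dt+\sigma\,dB^i_t .$$ Put $$t_*=\frac{d(\mathfrak b-1)}{\varepsilon},\qquad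 S^*_{t}=\sup_{0\le s\le t}\Bigl(\sum_{i=0}^{d}|Z^i_s-\mathcal X^i_s|^2\Bigr)^{1/2},\qquad \delta=\delta(\varepsilon,\sigma)=\frac{\theta\,\sigma}{\sqrt{\ln(\sigma/\varepsilon)}} .$$ Then, as $\varepsilon,\sigma\to0$ in such a way that $\sigma/\varepsilon\to\infty$ and $\sigma^2|\ln\varepsilon|^3\to0$, $$\mathbb P\bigl(S^*_{t_*}\ge\delta\bigr)\to 0 .$$ -/

import Mathlib

open MeasureTheory ProbabilityTheory Filter Topology
open scoped NNReal ENNReal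

noncomputable section

/-- Assumption P on the potential `U`, for the break distance `b`: `U` is three times continuously
differentiable and `U''` is strictly positive on `[1, b]`. -/
structure AssumptionP (U : ℝ → ℝ) (b : ℝ) : Prop where
  contDiff : ContDiff ℝ 3 U
  pos : ∀ x ∈ Set.Icc 1 b, 0 < iteratedDeriv 2 U x

/-- `B 0, …, B (n - 1)` are independent standard real Brownian motions. -/
structure IsIndepBrownianFamily {Ω : Type*} [MeasurableSpace Ω] (P : Measure Ω) {n : ℕ}
    (B : Fin n → ℝ≥0 → Ω → ℝ) : Prop where
  isBrownian : ∀ k, IsBrownianReal (B k) P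
  indep : iIndepFun (fun k ω t => B k t ω) P

/-- `X 0, …, X d` is a solution on `[0, ∞)` of the pulled chain of `d + 1` particles with
`X_0^i = i`, `X_t^0 = 0`, `X_t^d = d + ε t` and
`dX_t^i = F(t, X_t, i) dt + σ dB_t^i` for `1 ≤ i ≤ d - 1`.
The noise is additive, so the equation is meant pathwise, in integrated form.
The particle `i = k + 1` is driven by the Brownian motion `B k`, `k = 0, …, d - 2`. The values
`X i` with `i > d` play no role. -/
def SolvesPulledChain {Ω : Type*} [MeasurableSpace Ω] (P : Measure Ω) (d : ℕ) (ε σ : ℝ)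
    (B : Fin (d - 1) → ℝ≥0 → Ω → ℝ) (F : ℝ → (ℕ → ℝ) → ℕ → ℝ) (X : ℕ → ℝ → Ω → ℝ) : Prop :=
  ∀ᵐ ω ∂P,
    (∀ i ≤ d, ContinuousOn (fun t => X i t ω) (Set.Ici 0)) ∧
    (∀ i ≤ d, X i 0 ω = i) ∧
    (∀ t, 0 ≤ t → X 0 t ω = 0) ∧
    (∀ t, 0 ≤ t → X d t ω = d + ε * t) ∧
    (∀ k : Fin (d - 1), ∀ t, 0 ≤ t →
      X ((k : ℕ) + 1) t ω = X ((k : ℕ) + 1) 0 ω +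
          (∫ s in (0 : ℝ)..t, F s (fun j => X j s ω) ((k : ℕ) + 1))
        + σ * B k t.toNNReal ω)

/-- Nearest neighbour drift `U'(x_{i+1} - x_i) - U'(x_i - x_{i-1})` (used for `i ≥ 1`). -/
def nonlinearDrift (U : ℝ → ℝ) (_t : ℝ) (x : ℕ → ℝ) (i : ℕ) : ℝ :=
  deriv U (x (i + 1) - x i) - deriv U (x i - x (i - 1))

/-- The mean link length `q_t = 1 + ε t / d`. -/
def meanLink (d : ℕ) (ε t : ℝ) : ℝ := 1 + ε * t / d

/-- Linearised drift `φ(t) (x_{i+1} + x_{i-1} - 2 x_i)` with `φ(t) = U''(q_t)`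
(used for `i ≥ 1`). -/
def linearDrift (U : ℝ → ℝ) (d : ℕ) (ε t : ℝ) (x : ℕ → ℝ) (i : ℕ) : ℝ :=
  iteratedDeriv 2 U (meanLink d ε t) * (x (i + 1) + x (i - 1) - 2 * x i)

/-- The deterministic upper bound `t_* = d (b - 1) / ε` on the break time. -/
def tStar (d : ℕ) (b ε : ℝ) : ℝ := d * (b - 1) / ε

/-- The threshold `δ = θ σ / √(ln (σ / ε))`. -/
def deltaThreshold (θ ε σ : ℝ) : ℝ := θ * σ / Real.sqrt (Real.log (σ / ε))

/-- `S_t^* = sup_{0 ≤ s ≤ t} ‖Z_s - X_s‖₂`, with values in `[0, ∞]`. -/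
def SStar {Ω : Type*} (d : ℕ) (Z X : ℕ → ℝ → Ω → ℝ) (t : ℝ) (ω : Ω) : ℝ≥0∞ :=
  ⨆ s ∈ Set.Icc 0 t,
    ENNReal.ofReal (Real.sqrt (∑ i ∈ Finset.range (d + 1), (Z i s ω - X i s ω) ^ 2))

end

/-! Both chains shadow the equidistant configuration `i * meanLink d ε t`. Around it the linear
chain is a discrete heat equation with Dirichlet ends. By a discrete Poincaré inequality and the
positive minimum of `U''` on `[1, b]`, it dissipates energy at a rate bounded below until `tStar`.

The noise is treated path by path. Let `m` bound the oscillation of `σ B` over every unit time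
block. In each block the noise is restarted and subtracted; what remains solves an ODE with forcing
of order `m`. A ball of radius `H`, a suitable multiple of `m`, is mapped into itself by each full
block, so nothing accumulates over the roughly `1/ε` blocks (`sum_sq_le_of_heat_add_rough`,
`IsPulledChainPath.sum_sq_linear_le`).

In the difference of the two chains the noise cancels and the forcing is a Taylor remainder of `U'`,
quadratic in the deviation. Dissipation then keeps the difference of order `m ^ 2`
(`sum_sq_sub_le_of_nonlinear`, `exists_pathwise_bound`).

With `m` of order `σ √|ln ε|`, Gaussian tails give failure probability `O(ε ^ 2)` per block, hence
`O(ε)` in total. Finally `m ^ 2` lies below `δ` as soon as `σ |ln ε| ^ (3/2)` is small, which is the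
hypothesis on `σ`. -/

/-! ### Maximal inequality for Brownian motion by dyadic chaining. -/

/-- A dyadic point of level `k` is joined to `0` by crossing at most one dyadic interval of each
level up to `k`: an odd numerator costs one step, an even one drops to the coarser level. -/
theorem abs_sub_le_of_dyadic_increments_dyadic {f : ℝ → ℝ} {c : ℝ}
    (h : ∀ k j : ℕ, j < 2 ^ k → |f ((j + 1) / 2 ^ k) - f (j / 2 ^ k)| ≤ c * (3 / 4) ^ k)
    (k : ℕ) : ∀ j : ℕ, j ≤ 2 ^ k →
      |f (j / 2 ^ k) - f 0| ≤ c * ∑ i ∈ Finset.range (k + 1), (3 / 4 : ℝ) ^ i := by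
  have hc : 0 ≤ c := by simpa using (abs_nonneg _).trans (h 0 0 (by norm_num))
  induction k with
  | zero =>
    intro j hj
    have hj' : j = 0 ∨ j = 1 := by simp at hj; omega
    rcases hj' with rfl | rfl
    · simpa using hc
    · simpa using h 0 0 (by norm_num)
  | succ k ih =>
    intro j hj
    rw [Finset.sum_range_succ, mul_add]
    have hpos : 0 ≤ c * (3 / 4 : ℝ) ^ (k + 1) := by positivity
    have hhalf : ∀ m : ℕ, ((2 * m : ℕ) : ℝ) / 2 ^ (k + 1) = m / 2 ^ k := by
      intro m; push_cast; rw [pow_succ]; field_simp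
    rcases Nat.even_or_odd' j with ⟨m, rfl | rfl⟩
    · rw [hhalf]
      have := ih m (by rw [pow_succ] at hj; omega)
      linarith
    · have h1 := ih m (by rw [pow_succ] at hj; omega)
      have h2 := h (k + 1) (2 * m) (by omega)
      rw [hhalf] at h2
      have h3 : ((2 * m + 1 : ℕ) : ℝ) = ((2 * m : ℕ) : ℝ) + 1 := by push_cast; ring
      rw [h3]
      calc _ ≤ _ := abs_sub_le _ (f (m / 2 ^ k)) _
        _ ≤ _ := by linarith

/-- A continuous function whose dyadic increments decay geometrically is bounded on `[0, 1]`. -/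
theorem abs_sub_le_of_dyadic_increments {f : ℝ → ℝ} (hf : Continuous f) {c : ℝ}
    (h : ∀ k j : ℕ, j < 2 ^ k → |f ((j + 1) / 2 ^ k) - f (j / 2 ^ k)| ≤ c * (3 / 4) ^ k)
    {s : ℝ} (hs : s ∈ Set.Icc (0 : ℝ) 1) : |f s - f 0| ≤ 4 * c := by
  have hc : 0 ≤ c := by simpa using (abs_nonneg _).trans (h 0 0 (by norm_num))
  have hlim : Tendsto (fun k : ℕ => ((⌊s * 2 ^ k⌋₊ : ℕ) : ℝ) / 2 ^ k) atTop (𝓝 s) :=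
    (tendsto_nat_floor_mul_div_atTop hs.1).comp
      (tendsto_pow_atTop_atTop_of_one_lt (one_lt_two : (1 : ℝ) < 2))
  have hlim' := (((hf.tendsto s).comp hlim).sub_const (f 0)).abs
  refine le_of_tendsto hlim' (Eventually.of_forall fun k => ?_)
  refine (abs_sub_le_of_dyadic_increments_dyadic h k _ ?_).trans ?_
  · have : (⌊s * 2 ^ k⌋₊ : ℝ) ≤ 2 ^ k :=
      (Nat.floor_le (mul_nonneg hs.1 (by positivity))).trans
        (mul_le_of_le_one_left (by positivity) hs.2)
    exact_mod_cast this
  · have : ∑ i ∈ Finset.range (k + 1), (3 / 4 : ℝ) ^ i ≤ 4 := by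
      rw [geom_sum_eq (by norm_num), div_le_iff_of_neg (by norm_num)]
      have : (0 : ℝ) ≤ (3 / 4) ^ (k + 1) := by positivity
      linarith
    nlinarith

theorem hasSubgaussianMGF_of_hasLaw_gaussianReal {Ω : Type*} [MeasurableSpace Ω] {P : Measure Ω}
    {Y : Ω → ℝ} {v : ℝ≥0} (h : HasLaw Y (gaussianReal 0 v) P) : HasSubgaussianMGF Y v P where
  integrable_exp_mul t := by
    have := (integrable_map_measure (f := Y) (μ := P) (g := fun x => Real.exp (t * x))
      (by fun_prop) h.aemeasurable).1
    rw [h.map_eq] at this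
    exact this (integrable_exp_mul_gaussianReal t)
  mgf_le t := by
    rw [mgf_gaussianReal h.map_eq]
    simp

theorem ProbabilityTheory.IsPreBrownianReal.measure_abs_sub_gt_le {Ω : Type*} [MeasurableSpace Ω]
    {P : Measure Ω} [IsProbabilityMeasure P] {B : ℝ≥0 → Ω → ℝ} (hB : IsPreBrownianReal B P)
    (s t : ℝ≥0) {a : ℝ} (ha : 0 ≤ a) :
    P {ω | a < |B s ω - B t ω|} ≤
      ENNReal.ofReal (2 * Real.exp (-a ^ 2 / (2 * |(s : ℝ) - t|))) := by
  have h := hasSubgaussianMGF_of_hasLaw_gaussianReal (hB.hasLaw_sub s t)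
  have h1 := h.measure_ge_le ha
  have h2 := h.neg.measure_ge_le ha
  have hd : ((nndist s.1 t.1 : ℝ≥0) : ℝ) = |(s : ℝ) - t| := by
    rw [coe_nndist, Real.dist_eq]; rfl
  rw [hd] at h1 h2
  have hsub : {ω | a < |B s ω - B t ω|} ⊆
      {ω | a ≤ (B s - B t) ω} ∪ {ω | a ≤ (-(B s - B t)) ω} := by
    intro ω hω
    rcases lt_abs.1 (show a < |B s ω - B t ω| from hω) with h | h
    · exact Or.inl h.le
    · exact Or.inr (by simpa using h.le)
  refine (measure_mono hsub).trans ((measure_union_le _ _).trans ?_)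
  rw [two_mul, ENNReal.ofReal_add (Real.exp_nonneg _) (Real.exp_nonneg _)]
  refine add_le_add ?_ ?_
  · rw [← ofReal_measureReal]; exact ENNReal.ofReal_le_ofReal h1
  · rw [← ofReal_measureReal]; exact ENNReal.ofReal_le_ofReal h2

/-- Gaussian tail for the maximum of a Brownian motion over a unit interval. -/
theorem ProbabilityTheory.IsBrownianReal.measure_exists_gt_le {Ω : Type*} [MeasurableSpace Ω]
    {P : Measure Ω} [IsProbabilityMeasure P] {B : ℝ≥0 → Ω → ℝ} (hB : IsBrownianReal B P)
    {M : ℝ} (hM0 : 0 ≤ M) (hM : 2 * Real.exp (-M ^ 2 / 256) ≤ 1 / 2) :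
    P {ω | ¬ ∀ s ∈ Set.Icc (0 : ℝ) 1, |B s.toNNReal ω - B 0 ω| ≤ M} ≤
      ENNReal.ofReal (4 * Real.exp (-M ^ 2 / 32)) := by
  -- The factor `M / 4` offsets the sum `4` of the geometric series. The ratio `3 / 4` exceeds `1 /
  -- √2`, so the Gaussian exponent at level `k` grows like `(2 * (3 / 4) ^ 2) ^ k = (9 / 8) ^ k` and
  -- beats the `2 ^ k` intervals.
  set A : ℕ → ℕ → Set Ω := fun k j => {ω | M / 4 * (3 / 4) ^ k <
    |B ((j + 1) / 2 ^ k : ℝ).toNNReal ω - B (j / 2 ^ k : ℝ).toNNReal ω|} with hA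
  set N : Set Ω := {ω | ¬ Continuous (B · ω)}
  have hN : P N = 0 := hB.cont
  have hsub : {ω | ¬ ∀ s ∈ Set.Icc (0 : ℝ) 1, |B s.toNNReal ω - B 0 ω| ≤ M} ⊆
      N ∪ ⋃ k, ⋃ j ∈ Finset.range (2 ^ k), A k j := by
    intro ω hω
    by_contra hcon
    simp only [Set.mem_union, Set.mem_iUnion, not_or, not_exists, Finset.mem_range] at hcon
    refine hω fun s hs => ?_
    have hcont : Continuous (B · ω) := not_not.1 hcon.1
    have := abs_sub_le_of_dyadic_increments (f := fun s : ℝ => B s.toNNReal ω)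
      (hcont.comp continuous_real_toNNReal) (c := M / 4)
      (fun k j hj => not_lt.1 (hcon.2 k j hj)) hs
    simp only [Real.toNNReal_zero] at this
    linarith
  have hterm : ∀ k j, P (A k j) ≤
      ENNReal.ofReal (2 * Real.exp (-M ^ 2 / 32) * (1 / 4) ^ k) := by
    intro k j
    refine (hB.toIsPreBrownianReal.measure_abs_sub_gt_le _ _ (by positivity)).trans
      (ENNReal.ofReal_le_ofReal ?_)
    rw [Real.coe_toNNReal _ (by positivity), Real.coe_toNNReal _ (by positivity)]
    have h1 : |((j : ℝ) + 1) / 2 ^ k - j / 2 ^ k| = 1 / 2 ^ k := by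
      rw [← sub_div, add_sub_cancel_left, abs_of_pos (by positivity)]
    rw [h1]
    have h2 : -(M / 4 * (3 / 4) ^ k) ^ 2 / (2 * (1 / 2 ^ k)) = -M ^ 2 / 32 * (9 / 8 : ℝ) ^ k := by
      have : (9 / 8 : ℝ) ^ k = ((3 / 4) ^ k) ^ 2 * 2 ^ k := by
        rw [← pow_mul, mul_comm k 2, pow_mul, ← mul_pow]; norm_num
      rw [this]; field_simp; norm_num; ring
    rw [h2]
    -- Bernoulli makes the exponent linear in `k` with slope `M ^ 2 / 256`; the hypothesis on `M`
    -- turns this into a factor at most `1 / 4` per level.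
    have h3 : 1 + (k : ℝ) * (1 / 8) ≤ (9 / 8 : ℝ) ^ k := by
      have := one_add_mul_le_pow (a := (1 / 8 : ℝ)) (by norm_num) k
      norm_num at this ⊢
      linarith
    have h4 : Real.exp (-M ^ 2 / 256) ≤ 1 / 4 := by linarith
    calc 2 * Real.exp (-M ^ 2 / 32 * (9 / 8 : ℝ) ^ k)
        ≤ 2 * Real.exp (-M ^ 2 / 32 + k * (-M ^ 2 / 256)) := by
          gcongr
          nlinarith [sq_nonneg M]
      _ = 2 * Real.exp (-M ^ 2 / 32) * (Real.exp (-M ^ 2 / 256)) ^ k := by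
          rw [Real.exp_add, ← Real.exp_nat_mul]; ring
      _ ≤ _ := by gcongr
  have hlevel : ∀ k, P (⋃ j ∈ Finset.range (2 ^ k), A k j) ≤
      ENNReal.ofReal (2 * Real.exp (-M ^ 2 / 32) * (1 / 2) ^ k) := by
    intro k
    refine (measure_biUnion_finset_le _ _).trans ((Finset.sum_le_sum fun j _ => hterm k j).trans ?_)
    rw [Finset.sum_const, Finset.card_range, nsmul_eq_mul, ← ENNReal.ofReal_natCast,
      ← ENNReal.ofReal_mul (by positivity)]
    refine ENNReal.ofReal_le_ofReal (le_of_eq ?_)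
    have : (1 / 2 : ℝ) ^ k = 2 ^ k * (1 / 4) ^ k := by rw [← mul_pow]; norm_num
    rw [this]; push_cast; ring
  have hsum : HasSum (fun k : ℕ => 2 * Real.exp (-M ^ 2 / 32) * (1 / 2 : ℝ) ^ k)
      (4 * Real.exp (-M ^ 2 / 32)) := by
    have h := hasSum_geometric_two.mul_left (2 * Real.exp (-M ^ 2 / 32))
    rwa [mul_right_comm, show (2 * 2 : ℝ) = 4 by norm_num] at h
  calc _ ≤ _ := measure_mono hsub
    _ ≤ P N + P (⋃ k, ⋃ j ∈ Finset.range (2 ^ k), A k j) := measure_union_le _ _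
    _ ≤ 0 + ∑' k, ENNReal.ofReal (2 * Real.exp (-M ^ 2 / 32) * (1 / 2) ^ k) := by
        rw [hN]
        gcongr
        exact (measure_iUnion_le _).trans (ENNReal.tsum_le_tsum hlevel)
    _ = _ := by
        rw [zero_add, ← ENNReal.ofReal_tsum_of_nonneg (fun k => by positivity) hsum.summable,
          hsum.tsum_eq]

/-! ### Energy estimates for the discrete heat equation. -/

/-- Summation by parts. Under Dirichlet conditions the right boundary term becomes `-v n ^ 2`, which
has the good sign. -/
theorem sum_mul_laplacian_eq (v : ℕ → ℝ) (n : ℕ) :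
    ∑ i ∈ Finset.range n, v (i + 1) * (v (i + 2) + v i - 2 * v (i + 1)) =
      -∑ i ∈ Finset.range n, (v (i + 1) - v i) ^ 2 + v n * (v (n + 1) - v n)
        - v 0 * (v 1 - v 0) := by
  induction n with
  | zero => simp
  | succ n ih => rw [Finset.sum_range_succ, Finset.sum_range_succ, ih]; ring

/-- Discrete Poincaré inequality with Dirichlet condition at the left end. -/
theorem sum_sq_le_sum_sq_sub {v : ℕ → ℝ} (h0 : v 0 = 0) (n : ℕ) :
    ∑ i ∈ Finset.range n, v (i + 1) ^ 2 ≤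
      (n : ℝ) ^ 2 * ∑ i ∈ Finset.range n, (v (i + 1) - v i) ^ 2 := by
  have h : ∀ i ∈ Finset.range n,
      v (i + 1) ^ 2 ≤ n * ∑ j ∈ Finset.range n, (v (j + 1) - v j) ^ 2 := by
    intro i hi
    have hin : i + 1 ≤ n := Finset.mem_range.1 hi
    have h1 := sq_sum_le_card_mul_sum_sq (s := Finset.range (i + 1)) (f := fun j => v (j + 1) - v j)
    rw [Finset.sum_range_sub, h0, sub_zero, Finset.card_range] at h1
    refine h1.trans ?_
    have h2 : ((i + 1 : ℕ) : ℝ) ≤ n := by exact_mod_cast hin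
    refine mul_le_mul h2 ?_ (Finset.sum_nonneg fun _ _ => sq_nonneg _) (by positivity)
    exact Finset.sum_le_sum_of_subset_of_nonneg (Finset.range_mono hin) fun _ _ _ => sq_nonneg _
  refine (Finset.sum_le_sum h).trans (le_of_eq ?_)
  rw [Finset.sum_const, Finset.card_range, nsmul_eq_mul]; ring

/-- Dissipation of the energy of a forced discrete heat equation. -/
theorem two_mul_sum_mul_laplacian_add_le {v r : ℕ → ℝ} {n : ℕ} {φ l : ℝ} (h0 : v 0 = 0)
    (hn : v (n + 1) = 0) (hl : 0 < l) (hφ : l * (n : ℝ) ^ 2 ≤ φ) :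
    ∑ i ∈ Finset.range n, 2 * v (i + 1) * (φ * (v (i + 2) + v i - 2 * v (i + 1)) + r i) ≤
      -l * ∑ i ∈ Finset.range n, v (i + 1) ^ 2 + (∑ i ∈ Finset.range n, r i ^ 2) / l := by
  have h1 : ∑ i ∈ Finset.range n, v (i + 1) * (v (i + 2) + v i - 2 * v (i + 1)) ≤
      -∑ i ∈ Finset.range n, (v (i + 1) - v i) ^ 2 := by
    rw [sum_mul_laplacian_eq, h0, hn]
    nlinarith [sq_nonneg (v n)]
  have h2 := sum_sq_le_sum_sq_sub h0 n
  have h3 : 0 ≤ ∑ i ∈ Finset.range n, (v (i + 1) - v i) ^ 2 :=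
    Finset.sum_nonneg fun _ _ => sq_nonneg _
  have hφ0 : 0 ≤ φ := le_trans (by positivity) hφ
  -- Diffusion supplies dissipation `2 * l` times the energy; Young's inequality spends half of it
  -- on the forcing.
  have h4 : ∑ i ∈ Finset.range n, 2 * v (i + 1) * r i ≤
      l * ∑ i ∈ Finset.range n, v (i + 1) ^ 2 + (∑ i ∈ Finset.range n, r i ^ 2) / l := by
    rw [Finset.mul_sum, Finset.sum_div, ← Finset.sum_add_distrib]
    refine Finset.sum_le_sum fun i _ => ?_
    have : 0 ≤ (l * v (i + 1) - r i) ^ 2 / l := by positivity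
    have h5 : (l * v (i + 1) - r i) ^ 2 / l =
      l * v (i + 1) ^ 2 + r i ^ 2 / l - 2 * v (i + 1) * r i := by field_simp; ring
    linarith
  have h6 : ∑ i ∈ Finset.range n, 2 * v (i + 1) * (φ * (v (i + 2) + v i - 2 * v (i + 1)) + r i) =
      2 * φ * ∑ i ∈ Finset.range n, v (i + 1) * (v (i + 2) + v i - 2 * v (i + 1)) +
        ∑ i ∈ Finset.range n, 2 * v (i + 1) * r i := by
    rw [Finset.mul_sum, ← Finset.sum_add_distrib]
    exact Finset.sum_congr rfl fun i _ => by ring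
  rw [h6]
  have h7 : φ * ∑ i ∈ Finset.range n, v (i + 1) * (v (i + 2) + v i - 2 * v (i + 1)) ≤
      φ * -∑ i ∈ Finset.range n, (v (i + 1) - v i) ^ 2 := mul_le_mul_of_nonneg_left h1 hφ0
  have h8 := mul_le_mul_of_nonneg_left h2 hl.le
  have h9 := mul_le_mul_of_nonneg_right hφ h3
  linarith

/-- Fencing for the energy of a forced discrete heat equation under a linear boundary. -/
theorem sum_sq_le_of_heat {n : ℕ} {v : ℕ → ℝ → ℝ} {r : ℕ → ℝ → ℝ} {φ : ℝ → ℝ} {l a c G κ : ℝ}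
    (hl : 0 < l) (hκ : 0 ≤ κ)
    (hcont : ∀ i < n, ContinuousOn (v (i + 1)) (Set.Icc a c))
    (h0 : ∀ t ∈ Set.Icc a c, v 0 t = 0) (hn : ∀ t ∈ Set.Icc a c, v (n + 1) t = 0)
    (hφ : ∀ t ∈ Set.Icc a c, l * (n : ℝ) ^ 2 ≤ φ t)
    (hv : ∀ i < n, ∀ t ∈ Set.Ico a c, HasDerivWithinAt (v (i + 1))
      (φ t * (v (i + 2) t + v i t - 2 * v (i + 1) t) + r i t) (Set.Ici t) t)
    (hG : ∑ i ∈ Finset.range n, v (i + 1) a ^ 2 ≤ G)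
    (hr : ∀ t ∈ Set.Ico a c, ∑ i ∈ Finset.range n, v (i + 1) t ^ 2 ≤ G →
      (∑ i ∈ Finset.range n, r i t ^ 2) / l < l * (G - κ * (c - a)) - κ) :
    ∀ t ∈ Set.Icc a c, ∑ i ∈ Finset.range n, v (i + 1) t ^ 2 ≤ G - κ * (t - a) := by
  -- The derivatives are compared only at times when the energy meets the boundary. The forcing
  -- therefore needs a bound only while the energy is at most `G`, which permits a forcing that
  -- depends on the solution.
  refine image_le_of_deriv_right_lt_deriv_boundary
    (f := fun t => ∑ i ∈ Finset.range n, v (i + 1) t ^ 2)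
    (f' := fun t => ∑ i ∈ Finset.range n, 2 * v (i + 1) t *
      (φ t * (v (i + 2) t + v i t - 2 * v (i + 1) t) + r i t))
    (B := fun t => G - κ * (t - a)) (B' := fun _ => -κ) ?_ ?_ (by simpa using hG) ?_ ?_
  · exact continuousOn_finsetSum _ fun i hi => (hcont i (Finset.mem_range.1 hi)).pow 2
  · intro t ht
    refine HasDerivWithinAt.fun_sum fun i hi => ?_
    have h := (hv i (Finset.mem_range.1 hi) t ht).fun_pow 2
    simp only [Nat.cast_ofNat, Nat.add_one_sub_one, pow_one] at h
    exact h
  · intro t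
    simpa using (((hasDerivAt_id t).sub_const a).const_mul κ).const_sub G
  · intro t ht heq
    have ht' : t ∈ Set.Icc a c := Set.Ico_subset_Icc_self ht
    have h1 := two_mul_sum_mul_laplacian_add_le (v := fun i => v i t) (r := fun i => r i t)
      (h0 t ht') (hn t ht') hl (hφ t ht')
    have hle : κ * (t - a) ≤ κ * (c - a) := by gcongr; exact ht.2.le
    have h2 := hr t ht (by rw [heq]; nlinarith [ht.1])
    rw [heq] at h1
    nlinarith

/-- Restores the subtracted noise: `η = 1` gives a crude bound inside a block, and a small `η` a
sharp one at its end. -/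
theorem sum_sq_add_le (u w : ℕ → ℝ) (n : ℕ) {η : ℝ} (hη : 0 < η) :
    ∑ i ∈ Finset.range n, (u i + w i) ^ 2 ≤
      (1 + η) * ∑ i ∈ Finset.range n, u i ^ 2 + (1 + 1 / η) * ∑ i ∈ Finset.range n, w i ^ 2 := by
  rw [Finset.mul_sum, Finset.mul_sum, ← Finset.sum_add_distrib]
  refine Finset.sum_le_sum fun i _ => ?_
  have h : 0 ≤ (η * u i - w i) ^ 2 / η := by positivity
  have h' : (η * u i - w i) ^ 2 / η = η * u i ^ 2 + 1 / η * w i ^ 2 - 2 * u i * w i := by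
    field_simp; ring
  nlinarith

/-- One unit time step of a discrete heat equation driven by a small, possibly rough, forcing:
a large enough ball is invariant. -/
theorem sum_sq_le_of_heat_add_rough {n : ℕ} (hn1 : 1 ≤ n) {z w c : ℕ → ℝ → ℝ} {φ : ℝ → ℝ}
    {l Φ a e m H : ℝ} (hl : 0 < l) (hl1 : l ≤ 1) (hm : 0 < m)
    (hae : a ≤ e) (hea : e ≤ a + 1) (hH : 16 * (Φ + 1) * n * m / l ≤ H)
    (hcont : ∀ i < n, ContinuousOn (fun t => z (i + 1) t - w (i + 1) t) (Set.Icc a e))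
    (hz0 : ∀ t ∈ Set.Icc a e, z 0 t = 0) (hzn : ∀ t ∈ Set.Icc a e, z (n + 1) t = 0)
    (hw0 : ∀ t ∈ Set.Icc a e, w 0 t = 0) (hwn : ∀ t ∈ Set.Icc a e, w (n + 1) t = 0)
    (hwa : ∀ i < n, w (i + 1) a = 0)
    (hφ : ∀ t ∈ Set.Icc a e, l * (n : ℝ) ^ 2 ≤ φ t) (hΦ : ∀ t ∈ Set.Icc a e, φ t ≤ Φ)
    (hw : ∀ i < n, ∀ t ∈ Set.Icc a e, |w (i + 1) t| ≤ m)
    (hc : ∀ i < n, ∀ t ∈ Set.Icc a e, |c i t| ≤ m)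
    (hz : ∀ i < n, ∀ t ∈ Set.Ico a e, HasDerivWithinAt (fun t => z (i + 1) t - w (i + 1) t)
      (φ t * (z (i + 2) t + z i t - 2 * z (i + 1) t) + c i t) (Set.Ici t) t)
    (ha : ∑ i ∈ Finset.range n, z (i + 1) a ^ 2 ≤ H ^ 2) :
    (∀ t ∈ Set.Icc a e, ∑ i ∈ Finset.range n, z (i + 1) t ^ 2 ≤ 4 * H ^ 2) ∧
      (e = a + 1 → ∑ i ∈ Finset.range n, z (i + 1) e ^ 2 ≤ H ^ 2) := by
  have haI : a ∈ Set.Icc a e := ⟨le_rfl, hae⟩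
  have hn1' : (1 : ℝ) ≤ n := by exact_mod_cast hn1
  have hΦ0 : 0 ≤ Φ := (le_trans (by positivity) (hφ a haI)).trans (hΦ a haI)
  have hHl : 16 * (Φ + 1) * n * m ≤ l * H := by
    rw [div_le_iff₀ hl] at hH; linarith
  have hHl2 : 256 * ((Φ + 1) ^ 2 * n * m ^ 2) ≤ l ^ 2 * H ^ 2 := by
    have h1 : (16 * (Φ + 1) * n * m) ^ 2 ≤ (l * H) ^ 2 := pow_le_pow_left₀ (by positivity) hHl 2
    have h2 : (Φ + 1) ^ 2 * m ^ 2 * n ≤ (Φ + 1) ^ 2 * m ^ 2 * (n ^ 2 : ℝ) := by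
      gcongr; nlinarith
    nlinarith
  have hP : 0 < (Φ + 1) ^ 2 * n * m ^ 2 := by positivity
  have hnm : n * m ^ 2 ≤ (Φ + 1) ^ 2 * n * m ^ 2 := by
    rw [mul_assoc]
    exact le_mul_of_one_le_left (by positivity) (by nlinarith)
  have hww : ∀ i ≤ n + 1, ∀ t ∈ Set.Icc a e, |w i t| ≤ m := by
    intro i hi t ht
    rcases Nat.eq_zero_or_pos i with rfl | hi0
    · rw [hw0 t ht]; simpa using hm.le
    rcases Nat.lt_or_ge n i with h | h
    · rw [show i = n + 1 by omega, hwn t ht]; simpa using hm.le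
    · obtain ⟨j, rfl⟩ : ∃ j, i = j + 1 := ⟨i - 1, by omega⟩
      exact hw j (by omega) t ht
  have hsw : ∀ t ∈ Set.Icc a e, ∑ i ∈ Finset.range n, w (i + 1) t ^ 2 ≤ n * m ^ 2 := by
    intro t ht
    have : ∑ i ∈ Finset.range n, w (i + 1) t ^ 2 ≤ ∑ i ∈ Finset.range n, m ^ 2 :=
      Finset.sum_le_sum fun i hi => sq_le_sq.2
        ((hw i (Finset.mem_range.1 hi) t ht).trans (le_abs_self m))
    simpa using this
  -- The rough part `w` has no derivative, so it enters only through its Laplacian, as a bounded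
  -- forcing. The slope `κ` makes the energy lose the fraction `l / 4` over a full block.
  have key := sum_sq_le_of_heat (n := n) (v := fun i t => z i t - w i t)
    (r := fun i t => φ t * (w (i + 2) t + w i t - 2 * w (i + 1) t) + c i t) (φ := φ) (l := l)
    (a := a) (c := e) (G := H ^ 2) (κ := l / 4 * H ^ 2) hl (by positivity) hcont
    (fun t ht => by rw [hz0 t ht, hw0 t ht, sub_zero])
    (fun t ht => by rw [hzn t ht, hwn t ht, sub_zero]) hφ
    (fun i hi t ht => (hz i hi t ht).congr_deriv (by ring))
    (by
      refine le_trans (le_of_eq (Finset.sum_congr rfl fun i hi => ?_)) ha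
      rw [hwa i (Finset.mem_range.1 hi), sub_zero])
    (by
      intro t ht _
      have ht' : t ∈ Set.Icc a e := Set.Ico_subset_Icc_self ht
      have hr1 : ∀ i ∈ Finset.range n,
          (φ t * (w (i + 2) t + w i t - 2 * w (i + 1) t) + c i t) ^ 2 ≤ ((4 * Φ + 1) * m) ^ 2 := by
        intro i hi
        have hi' := Finset.mem_range.1 hi
        refine sq_le_sq.2 (le_trans ?_ (le_abs_self _))
        have h1 := abs_le.1 (hww (i + 2) (by omega) t ht')
        have h2 := abs_le.1 (hww (i + 1) (by omega) t ht')
        have h3 := abs_le.1 (hww i (by omega) t ht')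
        have h4 : |w (i + 2) t + w i t - 2 * w (i + 1) t| ≤ 4 * m :=
          abs_le.2 ⟨by linarith, by linarith⟩
        have h5 : |φ t| ≤ Φ := by
          rw [abs_of_nonneg (le_trans (by positivity) (hφ t ht'))]; exact hΦ t ht'
        calc _ ≤ |φ t * (w (i + 2) t + w i t - 2 * w (i + 1) t)| + |c i t| := abs_add_le _ _
          _ ≤ Φ * (4 * m) + m := by
            rw [abs_mul]
            exact add_le_add (mul_le_mul h5 h4 (abs_nonneg _) hΦ0) (hc i hi' t ht')
          _ = _ := by ring
      have hr2 := Finset.sum_le_sum hr1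
      rw [Finset.sum_const, Finset.card_range, nsmul_eq_mul] at hr2
      rw [div_lt_iff₀ hl]
      refine hr2.trans_lt ?_
      have h6 : (n : ℝ) * ((4 * Φ + 1) * m) ^ 2 ≤ 16 * ((Φ + 1) ^ 2 * n * m ^ 2) := by
        have : (4 * Φ + 1) ^ 2 ≤ 16 * (Φ + 1) ^ 2 := by nlinarith
        have h7 : 0 ≤ (n : ℝ) * m ^ 2 := by positivity
        nlinarith
      have h8 : l / 4 * H ^ 2 * (e - a) ≤ 1 / 4 * H ^ 2 * 1 := by
        gcongr
        · linarith
      have h9 : 0 ≤ l ^ 2 * H ^ 2 := by positivity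
      have h10 : l ^ 2 * (l / 4 * H ^ 2 * (e - a)) ≤ l ^ 2 * (1 / 4 * H ^ 2 * 1) := by gcongr
      nlinarith)
  have hl2H : l ^ 2 * H ^ 2 ≤ H ^ 2 := 
    mul_le_of_le_one_left (sq_nonneg _) (pow_le_one₀ hl.le hl1)
  constructor
  · intro t ht
    have h1 := key t ht
    have h2 := sum_sq_add_le (fun i => z (i + 1) t - w (i + 1) t) (fun i => w (i + 1) t) n one_pos
    simp only [sub_add_cancel] at h2
    have h3 := hsw t ht
    have h4 : 0 ≤ l / 4 * H ^ 2 * (t - a) := mul_nonneg (by positivity) (by linarith [ht.1])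
    linarith
  · intro he
    have heI : e ∈ Set.Icc a e := ⟨hae, le_rfl⟩
    have h1 := key e heI
    -- Since `(1 + l / 8) * (1 - l / 4) ≤ 1 - l / 8`, the choice `η = l / 8` leaves `l / 8 * H ^ 2`
    -- to pay for `w`.
    have h2 := sum_sq_add_le (fun i => z (i + 1) e - w (i + 1) e) (fun i => w (i + 1) e) n
      (show 0 < l / 8 by positivity)
    simp only [sub_add_cancel] at h2
    have h3 := hsw e heI
    rw [he, add_sub_cancel_left, mul_one, ← he] at h1
    have h4 : (1 + l / 8) * ∑ i ∈ Finset.range n, (z (i + 1) e - w (i + 1) e) ^ 2 ≤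
        (1 + l / 8) * (H ^ 2 - l / 4 * H ^ 2) := by gcongr
    have h5 : (1 + 1 / (l / 8)) * ∑ i ∈ Finset.range n, w (i + 1) e ^ 2 ≤ 9 / l * (n * m ^ 2) := by
      have : 1 + 1 / (l / 8) ≤ 9 / l := by
        rw [show (9 : ℝ) / l = 1 / l + 1 / (l / 8) by field_simp; norm_num]
        gcongr
        rwa [one_le_div hl]
      exact mul_le_mul this h3 (Finset.sum_nonneg fun _ _ => sq_nonneg _) (by positivity)
    have h6 : 9 / l * (n * m ^ 2) ≤ l / 8 * H ^ 2 := by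
      rw [div_mul_eq_mul_div, div_le_iff₀ hl]
      nlinarith
    nlinarith [sq_nonneg (l * H)]

/-! ### From the linear to the nonlinear chain: Taylor remainder and comparison. -/

/-- Second order Taylor bound, uniform over a compact interval of base points. -/
theorem exists_abs_taylor_remainder_le {f : ℝ → ℝ} (hf : ContDiff ℝ 2 f) (a b : ℝ) :
    ∃ C : ℝ, 0 ≤ C ∧ ∀ q ∈ Set.Icc a b, ∀ u : ℝ, |u| ≤ 1 →
      |f (q + u) - f q - deriv f q * u| ≤ C * u ^ 2 := by
  have hf' : ContDiff ℝ 1 (deriv f) := (contDiff_succ_iff_deriv.1 hf).2.2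
  obtain ⟨K, hK⟩ := (hf'.contDiffOn (s := Set.Icc (a - 1) (b + 1))).exists_lipschitzOnWith
    one_ne_zero (convex_Icc _ _) isCompact_Icc
  refine ⟨K, K.2, fun q hq u hu => ?_⟩
  have hu' := abs_le.1 hu
  have hder : ∀ x ∈ Set.uIcc q (q + u), HasDerivWithinAt (fun x => f x - deriv f q * x)
      (deriv f x - deriv f q) (Set.uIcc q (q + u)) x := by
    intro x _
    have h1 := (hf.differentiable (by norm_num) x).hasDerivAt
    have h2 := (hasDerivAt_id x).const_mul (deriv f q)
    simpa using (h1.fun_sub h2).hasDerivWithinAt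
  have hbd : ∀ x ∈ Set.uIcc q (q + u), ‖deriv f x - deriv f q‖ ≤ K * |u| := by
    intro x hx
    have hxq : |x - q| ≤ |u| := by
      simpa using Set.abs_sub_left_of_mem_uIcc hx
    have hxq' := abs_le.1 (hxq.trans hu)
    have hxI : x ∈ Set.Icc (a - 1) (b + 1) := ⟨by linarith [hq.1], by linarith [hq.2]⟩
    have hqI : q ∈ Set.Icc (a - 1) (b + 1) := ⟨by linarith [hq.1], by linarith [hq.2]⟩
    refine (hK.norm_sub_le hxI hqI).trans ?_
    exact mul_le_mul_of_nonneg_left hxq K.2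
  have h := (convex_uIcc q (q + u)).norm_image_sub_le_of_norm_hasDerivWithin_le hder hbd
    Set.left_mem_uIcc Set.right_mem_uIcc
  rw [add_sub_cancel_left, Real.norm_eq_abs, Real.norm_eq_abs] at h
  calc _ = |f (q + u) - deriv f q * (q + u) - (f q - deriv f q * q)| := by congr 1; ring
    _ ≤ _ := h
    _ = _ := by rw [mul_assoc, ← sq, sq_abs]

/-- Pathwise form of an integral equation with additive noise. -/
theorem hasDerivWithinAt_sub_of_integral_eq {y N F : ℝ → ℝ} {y0 : ℝ}
    (hF : ContinuousOn F (Set.Ici 0))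
    (h : ∀ t, 0 ≤ t → y t = y0 + (∫ s in (0 : ℝ)..t, F s) + N t) {t : ℝ} (ht : 0 ≤ t) :
    HasDerivWithinAt (fun t => y t - N t) (F t) (Set.Ici 0) t := by
  -- Extending `F` by a constant to negative times makes the fundamental theorem of calculus
  -- available at `0` too.
  have hG : Continuous fun s => F (max s 0) :=
    hF.comp_continuous (by fun_prop) fun s =>
      Set.mem_Ici.2 (le_max_right _ _)
  have hd := (hG.integral_hasStrictDerivAt 0 t).hasDerivAt.const_add y0
  rw [max_eq_left ht] at hd
  refine hd.hasDerivWithinAt.congr_of_mem (fun u hu => ?_) ht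
  rw [h u hu, add_sub_cancel_right]
  congr 1
  refine intervalIntegral.integral_congr fun s hs => ?_
  rw [Set.uIcc_of_le hu] at hs
  simp only [max_eq_left hs.1]

theorem sum_range_sq_eq_of_zero {v : ℕ → ℝ} {n : ℕ} (h0 : v 0 = 0) (hn : v (n + 1) = 0) :
    ∑ i ∈ Finset.range (n + 1 + 1), v i ^ 2 = ∑ i ∈ Finset.range n, v (i + 1) ^ 2 := by
  rw [Finset.sum_range_succ, Finset.sum_range_succ', h0, hn]
  ring

theorem abs_le_of_sum_sq_le {v : ℕ → ℝ} {n : ℕ} {A : ℝ} (hA : 0 ≤ A) (h0 : v 0 = 0)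
    (hn : v (n + 1) = 0) (h : ∑ i ∈ Finset.range n, v (i + 1) ^ 2 ≤ A ^ 2) {i : ℕ}
    (hi : i ≤ n + 1) : |v i| ≤ A := by
  refine abs_le_of_sq_le_sq (le_trans ?_ h) hA
  rw [← sum_range_sq_eq_of_zero h0 hn]
  exact Finset.single_le_sum (f := fun i => v i ^ 2) (fun _ _ => sq_nonneg _)
    (Finset.mem_range.2 (by omega))

/-- Comparison of the nonlinear and the linear chain: if the linear one stays `H`-close to the
equidistant configuration, the difference is of order `H ^ 2`. -/
theorem sum_sq_sub_le_of_nonlinear {n : ℕ} (hn1 : 1 ≤ n) {g : ℝ → ℝ} {φ q : ℝ → ℝ}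
    {x z : ℕ → ℝ → ℝ} {l C T H ρ : ℝ} (hl : 0 < l) (hC : 0 ≤ C) (hH : 0 < H) (hH1 : 6 * H ≤ 1)
    (hρ : ρ = 73 * (C + 1) * n * H ^ 2 / l) (hρH : ρ ≤ H)
    (hg : ∀ t ∈ Set.Icc 0 T, ∀ u, |u| ≤ 1 → |g (q t + u) - g (q t) - φ t * u| ≤ C * u ^ 2)
    (hφ : ∀ t ∈ Set.Icc 0 T, l * (n : ℝ) ^ 2 ≤ φ t)
    (hcont : ∀ i < n, ContinuousOn (fun t => z (i + 1) t - x (i + 1) t) (Set.Icc 0 T))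
    (hz0 : ∀ t ∈ Set.Icc 0 T, z 0 t = 0) (hzn : ∀ t ∈ Set.Icc 0 T, z (n + 1) t = 0)
    (hx0 : ∀ t ∈ Set.Icc 0 T, x 0 t = 0) (hxn : ∀ t ∈ Set.Icc 0 T, x (n + 1) t = 0)
    (hinit : ∀ i < n, z (i + 1) 0 = x (i + 1) 0)
    (hder : ∀ i < n, ∀ t ∈ Set.Ico 0 T, HasDerivWithinAt (fun t => z (i + 1) t - x (i + 1) t)
      (φ t * (z (i + 2) t + z i t - 2 * z (i + 1) t) -
        (g (q t + (x (i + 2) t - x (i + 1) t)) - g (q t + (x (i + 1) t - x i t)))) (Set.Ici t) t)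
    (hz : ∀ t ∈ Set.Icc 0 T, ∑ i ∈ Finset.range n, z (i + 1) t ^ 2 ≤ (2 * H) ^ 2) :
    ∀ t ∈ Set.Icc 0 T, ∑ i ∈ Finset.range n, (z (i + 1) t - x (i + 1) t) ^ 2 ≤ ρ ^ 2 := by
  have hn1' : (1 : ℝ) ≤ n := by exact_mod_cast hn1
  have hρ0 : 0 < ρ := by rw [hρ]; positivity
  set r : ℕ → ℝ → ℝ := fun i t =>
    -(g (q t + (x (i + 2) t - x (i + 1) t)) - g (q t) - φ t * (x (i + 2) t - x (i + 1) t)) +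
      (g (q t + (x (i + 1) t - x i t)) - g (q t) - φ t * (x (i + 1) t - x i t)) with hr
  have key := sum_sq_le_of_heat (n := n) (v := fun i t => z i t - x i t) (r := r) (φ := φ)
    (l := l) (a := 0) (c := T) (G := ρ ^ 2) (κ := 0) hl le_rfl hcont
    (fun t ht => by rw [hz0 t ht, hx0 t ht, sub_zero])
    (fun t ht => by rw [hzn t ht, hxn t ht, sub_zero]) hφ
    (fun i hi t ht => (hder i hi t ht).congr_deriv (by simp only [hr]; ring))
    (by
      refine le_trans (le_of_eq (Finset.sum_eq_zero fun i hi => ?_)) (sq_nonneg ρ)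
      rw [hinit i (Finset.mem_range.1 hi), sub_self]; norm_num)
    (by
      intro t ht hle
      have ht' : t ∈ Set.Icc 0 T := Set.Ico_subset_Icc_self ht
      -- Here `2 * H` comes from `z` and `ρ ≤ H` from the barrier on `z - x`. Link deviations are
      -- then at most `6 * H ≤ 1`, and two remainders of size `36 * C * H ^ 2` give the `72` below;
      -- `73 * (C + 1)` in `ρ` keeps the inequality strict even for `C = 0`.
      have hxb : ∀ i ≤ n + 1, |x i t| ≤ 3 * H := by
        intro i hi
        have h1 := abs_le.1 (abs_le_of_sum_sq_le (v := fun i => z i t) (by positivity)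
          (hz0 t ht') (hzn t ht') (hz t ht') hi)
        have h2 := abs_le.1 (abs_le_of_sum_sq_le (v := fun i => z i t - x i t) hρ0.le
          (by rw [hz0 t ht', hx0 t ht', sub_zero]) (by rw [hzn t ht', hxn t ht', sub_zero]) hle hi)
        exact abs_le.2 ⟨by linarith, by linarith⟩
      have hrem : ∀ i < n + 1, |g (q t + (x (i + 1) t - x i t)) - g (q t) -
          φ t * (x (i + 1) t - x i t)| ≤ C * (36 * H ^ 2) := by
        intro i hi
        have h1 := abs_le.1 (hxb (i + 1) (by omega))
        have h2 := abs_le.1 (hxb i (by omega))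
        have h3 : |x (i + 1) t - x i t| ≤ 6 * H := abs_le.2 ⟨by linarith, by linarith⟩
        refine (hg t ht' _ (h3.trans hH1)).trans (mul_le_mul_of_nonneg_left ?_ hC)
        calc _ ≤ (6 * H) ^ 2 := sq_le_sq' (abs_le.1 h3).1 (abs_le.1 h3).2
          _ = _ := by ring
      have hrb : ∀ i ∈ Finset.range n, r i t ^ 2 ≤ (72 * C * H ^ 2) ^ 2 := by
        intro i hi
        have hi' := Finset.mem_range.1 hi
        have h1 := abs_le.1 (hrem (i + 1) (by omega))
        have h2 := abs_le.1 (hrem i (by omega))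
        exact sq_le_sq' (by simp only [hr]; linarith) (by simp only [hr]; linarith)
      have hrs := Finset.sum_le_sum hrb
      rw [Finset.sum_const, Finset.card_range, nsmul_eq_mul] at hrs
      rw [div_lt_iff₀ hl]
      refine hrs.trans_lt ?_
      have h1 : l * (ρ ^ 2 - 0 * (T - 0)) - 0 = l * ρ ^ 2 := by ring
      have h2 : l * ρ ^ 2 * l = (73 * (C + 1) * n * H ^ 2) ^ 2 := by
        rw [hρ]; field_simp
      rw [h1, h2]
      calc (n : ℝ) * (72 * C * H ^ 2) ^ 2 ≤ n ^ 2 * (72 * C * H ^ 2) ^ 2 := by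
            gcongr; nlinarith
        _ = (72 * C * n * H ^ 2) ^ 2 := by ring
        _ < _ := by
          gcongr
          · norm_num
          · linarith)
  intro t ht
  simpa using key t ht

/-! ### Deterministic estimates along one path of the chain. -/

/-- A single path of the pulled chain. -/
def IsPulledChainPath (d : ℕ) (ε σ : ℝ) (β : Fin (d - 1) → ℝ≥0 → ℝ)
    (F : ℝ → (ℕ → ℝ) → ℕ → ℝ) (x : ℕ → ℝ → ℝ) : Prop :=
  (∀ i ≤ d, ContinuousOn (x i) (Set.Ici 0)) ∧
  (∀ i ≤ d, x i 0 = i) ∧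
  (∀ t, 0 ≤ t → x 0 t = 0) ∧
  (∀ t, 0 ≤ t → x d t = d + ε * t) ∧
  (∀ k : Fin (d - 1), ∀ t, 0 ≤ t →
    x ((k : ℕ) + 1) t = x ((k : ℕ) + 1) 0 +
        (∫ s in (0 : ℝ)..t, F s (fun j => x j s) ((k : ℕ) + 1))
      + σ * β k t.toNNReal)

section Path

variable {d : ℕ} {ε σ : ℝ} {β : Fin (d - 1) → ℝ≥0 → ℝ} {U : ℝ → ℝ} {b : ℝ}

theorem AssumptionP.contDiff_deriv (hU : AssumptionP U b) : ContDiff ℝ 2 (deriv U) :=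
  (contDiff_succ_iff_deriv.1 (show ContDiff ℝ (2 + 1) U by
    have := hU.contDiff; norm_num; exact this)).2.2

theorem AssumptionP.continuous_iteratedDeriv_two (hU : AssumptionP U b) :
    Continuous (iteratedDeriv 2 U) :=
  hU.contDiff.continuous_iteratedDeriv 2 (by norm_num)

theorem iteratedDeriv_two_eq (U : ℝ → ℝ) (x : ℝ) : iteratedDeriv 2 U x = deriv (deriv U) x := by
  rw [iteratedDeriv_succ, iteratedDeriv_one]

theorem IsPulledChainPath.hasDerivWithinAt_linear {z : ℕ → ℝ → ℝ}
    (hz : IsPulledChainPath d ε σ β (linearDrift U d ε) z) (hU : AssumptionP U b)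
    (k : Fin (d - 1)) {t : ℝ} (ht : 0 ≤ t) :
    HasDerivWithinAt (fun t => z (k + 1) t - σ * β k t.toNNReal)
      (iteratedDeriv 2 U (meanLink d ε t) * (z (k + 2) t + z k t - 2 * z (k + 1) t))
      (Set.Ici 0) t := by
  have hk := k.2
  have h := hasDerivWithinAt_sub_of_integral_eq (y := z (k + 1))
    (N := fun t => σ * β k t.toNNReal)
    (F := fun s => linearDrift U d ε s (fun j => z j s) (k + 1)) (y0 := z (k + 1) 0) ?_
    (fun t ht => hz.2.2.2.2 k t ht) ht
  · exact h
  · have h1 := hU.continuous_iteratedDeriv_two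
    have h2 : Continuous fun s => iteratedDeriv 2 U (meanLink d ε s) :=
      h1.comp (by unfold meanLink; fun_prop)
    exact h2.continuousOn.mul (((hz.1 _ (by omega)).add (hz.1 _ (by simp; omega))).sub
      (continuousOn_const.mul (hz.1 _ (by omega))))

theorem IsPulledChainPath.hasDerivWithinAt_nonlinear {x : ℕ → ℝ → ℝ}
    (hx : IsPulledChainPath d ε σ β (nonlinearDrift U) x) (hU : AssumptionP U b)
    (k : Fin (d - 1)) {t : ℝ} (ht : 0 ≤ t) :
    HasDerivWithinAt (fun t => x (k + 1) t - σ * β k t.toNNReal)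
      (deriv U (x (k + 2) t - x (k + 1) t) - deriv U (x (k + 1) t - x k t))
      (Set.Ici 0) t := by
  have hk := k.2
  have h := hasDerivWithinAt_sub_of_integral_eq (y := x (k + 1))
    (N := fun t => σ * β k t.toNNReal)
    (F := fun s => nonlinearDrift U s (fun j => x j s) (k + 1)) (y0 := x (k + 1) 0) ?_
    (fun t ht => hx.2.2.2.2 k t ht) ht
  · exact h
  · have h1 := hU.contDiff_deriv.continuous
    exact (h1.comp_continuousOn ((hx.1 _ (by omega)).sub (hx.1 _ (by omega)))).sub
      (h1.comp_continuousOn ((hx.1 _ (by omega)).sub (hx.1 _ (by simp; omega))))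

theorem hasDerivAt_meanLink (d : ℕ) (ε t : ℝ) : HasDerivAt (meanLink d ε) (ε / d) t := by
  have := (((hasDerivAt_id t).const_mul ε).div_const (d : ℝ)).const_add 1
  exact this.congr_deriv (by ring)

theorem natCast_mul_meanLink (hd : d ≠ 0) (ε t : ℝ) : d * meanLink d ε t = d + ε * t := by
  unfold meanLink
  have : (d : ℝ) ≠ 0 := by exact_mod_cast hd
  field_simp

theorem meanLink_mem_Icc (hd : d ≠ 0) (hε : 0 < ε) {t : ℝ} (ht : t ∈ Set.Icc 0 (tStar d b ε)) :
    meanLink d ε t ∈ Set.Icc 1 b := by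
  have hd' : (0 : ℝ) < d := by positivity
  have h2 := ht.2
  unfold tStar at h2
  rw [le_div_iff₀ hε] at h2
  unfold meanLink
  constructor
  · have : 0 ≤ ε * t / d := div_nonneg (mul_nonneg hε.le ht.1) hd'.le
    linarith
  · have : ε * t / d ≤ b - 1 := by rw [div_le_iff₀ hd']; linarith
    linarith

/-- If the driving paths have small oscillation over unit time blocks, the linear chain stays
close to the equidistant configuration. -/
theorem IsPulledChainPath.sum_sq_linear_le {z : ℕ → ℝ → ℝ} (hd : 2 ≤ d) (hε : 0 < ε)
    (hU : AssumptionP U b) (hz : IsPulledChainPath d ε σ β (linearDrift U d ε) z)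
    {l Φ m H : ℝ} (hl : 0 < l) (hl1 : l ≤ 1)
    (hlφ : ∀ q ∈ Set.Icc 1 b, l * ((d - 1 : ℕ) : ℝ) ^ 2 ≤ iteratedDeriv 2 U q)
    (hΦ : ∀ q ∈ Set.Icc 1 b, iteratedDeriv 2 U q ≤ Φ)
    (hm : ε ≤ m) (hH : 16 * (Φ + 1) * (d - 1 : ℕ) * m / l ≤ H)
    (hβ : ∀ k, ∀ j : ℕ, (j : ℝ) ≤ tStar d b ε → ∀ t ∈ Set.Icc (j : ℝ) (j + 1),
      |σ * (β k t.toNNReal - β k j)| ≤ m) :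
    ∀ t ∈ Set.Icc 0 (tStar d b ε),
      ∑ i ∈ Finset.range (d - 1), (z (i + 1) t - ((i + 1 : ℕ) : ℝ) * meanLink d ε t) ^ 2 ≤
        (2 * H) ^ 2 := by
  have hd0 : d ≠ 0 := by omega
  have hdpos : (0 : ℝ) < d := by positivity
  have hd1 : d - 1 + 1 = d := by omega
  set T := tStar d b ε with hT
  have hstep : ∀ j : ℕ, ∀ e : ℝ, j ≤ e → e ≤ j + 1 → e ≤ T →
      ∑ i ∈ Finset.range (d - 1), (z (i + 1) j - ((i + 1 : ℕ) : ℝ) * meanLink d ε j) ^ 2 ≤ H ^ 2 →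
      (∀ t ∈ Set.Icc (j : ℝ) e, ∑ i ∈ Finset.range (d - 1),
        (z (i + 1) t - ((i + 1 : ℕ) : ℝ) * meanLink d ε t) ^ 2 ≤ 4 * H ^ 2) ∧
      (e = j + 1 → ∑ i ∈ Finset.range (d - 1),
        (z (i + 1) e - ((i + 1 : ℕ) : ℝ) * meanLink d ε e) ^ 2 ≤ H ^ 2) := by
    intro j e hje hej heT hini
    have hj0 : (0 : ℝ) ≤ j := Nat.cast_nonneg j
    have hsub : ∀ t ∈ Set.Icc (j : ℝ) e, t ∈ Set.Icc 0 T := fun t ht =>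
      ⟨hj0.trans ht.1, ht.2.trans heT⟩
    -- Noise restarted at time `j`, and zero at the two end particles; `1 ≤ i` is needed because `0
    -- - 1 = 0` in `ℕ`.
    set w : ℕ → ℝ → ℝ := fun i t => if h : 1 ≤ i ∧ i - 1 < d - 1 then
      σ * (β ⟨i - 1, h.2⟩ t.toNNReal - β ⟨i - 1, h.2⟩ j) else 0 with hwdef
    have hwi : ∀ (i : ℕ) (hi : i < d - 1) (t : ℝ),
        w (i + 1) t = σ * (β ⟨i, hi⟩ t.toNNReal - β ⟨i, hi⟩ j) := by
      intro i hi t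
      simp [hwdef, hi]
    have hder : ∀ i < d - 1, ∀ t ∈ Set.Icc (j : ℝ) e, HasDerivWithinAt
        (fun t => z (i + 1) t - ((i + 1 : ℕ) : ℝ) * meanLink d ε t - w (i + 1) t)
        (iteratedDeriv 2 U (meanLink d ε t) *
          ((z (i + 2) t - ((i + 2 : ℕ) : ℝ) * meanLink d ε t) +
            (z i t - (i : ℝ) * meanLink d ε t) -
            2 * (z (i + 1) t - ((i + 1 : ℕ) : ℝ) * meanLink d ε t)) +
          -(((i + 1 : ℕ) : ℝ) * (ε / d))) (Set.Ici 0) t := by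
      intro i hi t ht
      have h1 := hz.hasDerivWithinAt_linear hU ⟨i, hi⟩ (hsub t ht).1
      have h2 := ((hasDerivAt_meanLink d ε t).const_mul ((i + 1 : ℕ) : ℝ)).hasDerivWithinAt
        (s := Set.Ici 0)
      have h3 := (h1.fun_sub h2).add_const (σ * β ⟨i, hi⟩ j)
      refine (h3.congr_deriv ?_).congr_of_mem (fun u _ => ?_) (hsub t ht).1
      · push_cast; ring
      · rw [hwi i hi]; ring
    refine sum_sq_le_of_heat_add_rough (n := d - 1) (by omega)
      (z := fun i t => z i t - (i : ℝ) * meanLink d ε t) (w := w)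
      (c := fun i _ => -(((i + 1 : ℕ) : ℝ) * (ε / d)))
      (φ := fun t => iteratedDeriv 2 U (meanLink d ε t)) hl hl1 (hε.trans_le hm) hje hej hH
      ?_ ?_ ?_ ?_ ?_ ?_ ?_ ?_ ?_ ?_ ?_ hini
    · intro i hi t ht
      exact ((hder i hi t ht).continuousWithinAt).mono fun u hu => (hsub u hu).1
    · intro t ht
      simp [hz.2.2.1 t (hsub t ht).1]
    · intro t ht
      simp only [hd1]
      rw [hz.2.2.2.1 t (hsub t ht).1, natCast_mul_meanLink hd0, sub_self]
    · intro t _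
      simp [hwdef]
    · intro t _
      simp [hwdef]
    · intro i hi
      rw [hwi i hi]; simp
    · exact fun t ht => hlφ _ (meanLink_mem_Icc hd0 hε (hsub t ht))
    · exact fun t ht => hΦ _ (meanLink_mem_Icc hd0 hε (hsub t ht))
    · intro i hi t ht
      rw [hwi i hi]
      exact hβ _ j (hje.trans heT) t ⟨ht.1, ht.2.trans hej⟩
    · intro i hi t _
      have h1 : ((i + 1 : ℕ) : ℝ) ≤ d := by exact_mod_cast (by omega : i + 1 ≤ d)
      rw [abs_neg, abs_of_nonneg (by positivity)]
      calc ((i + 1 : ℕ) : ℝ) * (ε / d) ≤ d * (ε / d) := by gcongr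
        _ = ε := by field_simp
        _ ≤ m := hm
    · intro i hi t ht
      have htI : t ∈ Set.Icc (j : ℝ) e := Set.Ico_subset_Icc_self ht
      exact (hder i hi t htI).mono (Set.Ici_subset_Ici.2 (hsub t htI).1)
  have hinv : ∀ j : ℕ, (j : ℝ) ≤ T → ∑ i ∈ Finset.range (d - 1),
      (z (i + 1) j - ((i + 1 : ℕ) : ℝ) * meanLink d ε j) ^ 2 ≤ H ^ 2 := by
    intro j
    induction j with
    | zero =>
      intro _
      refine le_trans (le_of_eq (Finset.sum_eq_zero fun i hi => ?_)) (sq_nonneg H)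
      have := Finset.mem_range.1 hi
      simp [hz.2.1 (i + 1) (by omega), meanLink]
    | succ j ih =>
      intro hj
      push_cast at hj
      have := (hstep j (j + 1) (by linarith) le_rfl hj (ih (by linarith))).2 rfl
      exact_mod_cast this
  intro t ht
  have hfl : (⌊t⌋₊ : ℝ) ≤ t := Nat.floor_le ht.1
  have h := (hstep ⌊t⌋₊ t hfl (Nat.lt_floor_add_one t).le ht.2 (hinv _ (hfl.trans ht.2))).1 t
    ⟨hfl, le_rfl⟩
  linarith

/-- Pathwise comparison of the nonlinear and the linearised chain. -/
theorem exists_pathwise_bound (hd : 2 ≤ d) (hb : 1 < b) (hU : AssumptionP U b) :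
    ∃ K : ℝ, 0 < K ∧ ∀ (ε σ m : ℝ) (β : Fin (d - 1) → ℝ≥0 → ℝ) (x z : ℕ → ℝ → ℝ),
      0 < ε → ε ≤ m → K * m ≤ 1 →
      IsPulledChainPath d ε σ β (nonlinearDrift U) x →
      IsPulledChainPath d ε σ β (linearDrift U d ε) z →
      (∀ k, ∀ j : ℕ, (j : ℝ) ≤ tStar d b ε → ∀ t ∈ Set.Icc (j : ℝ) (j + 1),
        |σ * (β k t.toNNReal - β k j)| ≤ m) →
      ∀ t ∈ Set.Icc 0 (tStar d b ε),
        ∑ i ∈ Finset.range (d + 1), (z i t - x i t) ^ 2 ≤ (K * m ^ 2) ^ 2 := by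
  have hd0 : d ≠ 0 := by omega
  have hd1 : d - 1 + 1 = d := by omega
  set n := d - 1 with hn
  have hn1 : 1 ≤ n := by omega
  have hn1' : (1 : ℝ) ≤ n := by exact_mod_cast hn1
  have hcont := hU.continuous_iteratedDeriv_two
  have hne : (Set.Icc 1 b).Nonempty := ⟨1, le_rfl, hb.le⟩
  obtain ⟨q0, hq0, hmin⟩ := isCompact_Icc.exists_isMinOn hne hcont.continuousOn
  obtain ⟨q1, hq1, hmax⟩ := isCompact_Icc.exists_isMaxOn hne hcont.continuousOn
  obtain ⟨C, hC, hT⟩ := exists_abs_taylor_remainder_le hU.contDiff_deriv 1 b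
  set Φ := iteratedDeriv 2 U q1
  have hΦ0 : 0 < Φ := hU.pos q1 hq1
  set l := min 1 (iteratedDeriv 2 U q0 / (n : ℝ) ^ 2) with hldef
  have hl : 0 < l := lt_min one_pos (div_pos (hU.pos q0 hq0) (by positivity))
  have hl1 : l ≤ 1 := min_le_left _ _
  have hlφ : ∀ q ∈ Set.Icc 1 b, l * (n : ℝ) ^ 2 ≤ iteratedDeriv 2 U q := by
    intro q hq
    have h1 : l ≤ iteratedDeriv 2 U q0 / (n : ℝ) ^ 2 := min_le_right _ _
    rw [le_div_iff₀ (by positivity)] at h1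
    exact h1.trans (hmin hq)
  have hΦ : ∀ q ∈ Set.Icc 1 b, iteratedDeriv 2 U q ≤ Φ := fun q hq => hmax hq
  set A := 16 * (Φ + 1) * n / l with hA
  set E := 73 * (C + 1) * n / l with hE
  have hA0 : 0 < A := by positivity
  have hE0 : 0 < E := by positivity
  have hE6 : 6 ≤ E := by
    rw [hE, le_div_iff₀ hl]
    nlinarith [mul_nonneg hC (zero_le_one.trans hn1')]
  -- With `H = A * m` and `ρ = E * H ^ 2`, the first summand gives `ρ ≤ K * m ^ 2`. The second turns
  -- `K * m ≤ 1` into `E * H ≤ 1`, hence `ρ ≤ H`, and `6 * H ≤ 1` because `6 ≤ E`.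
  refine ⟨E * A ^ 2 + E * A, by positivity, ?_⟩
  intro ε σ m β x z hε hεm hKm hx hz hβ
  have hm : 0 < m := hε.trans_le hεm
  set T := tStar d b ε
  have hEAm : E * (A * m) ≤ 1 := by
    have : 0 ≤ E * A ^ 2 * m := by positivity
    nlinarith
  have hH : 16 * (Φ + 1) * n * m / l = A * m := by rw [hA]; ring
  have hzb := hz.sum_sq_linear_le hd hε hU hl hl1 hlφ hΦ hεm hH.le hβ
  have hHpos : 0 < A * m := by positivity
  have hz0 : ∀ t ∈ Set.Icc 0 T, z 0 t - ((0 : ℕ) : ℝ) * meanLink d ε t = 0 := by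
    intro t ht; simp [hz.2.2.1 t ht.1]
  have hx0 : ∀ t ∈ Set.Icc 0 T, x 0 t - ((0 : ℕ) : ℝ) * meanLink d ε t = 0 := by
    intro t ht; simp [hx.2.2.1 t ht.1]
  have hzn : ∀ t ∈ Set.Icc 0 T, z (n + 1) t - ((n + 1 : ℕ) : ℝ) * meanLink d ε t = 0 := by
    intro t ht
    rw [hd1, hz.2.2.2.1 t ht.1, natCast_mul_meanLink hd0, sub_self]
  have hxn : ∀ t ∈ Set.Icc 0 T, x (n + 1) t - ((n + 1 : ℕ) : ℝ) * meanLink d ε t = 0 := by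
    intro t ht
    rw [hd1, hx.2.2.2.1 t ht.1, natCast_mul_meanLink hd0, sub_self]
  have hbound := sum_sq_sub_le_of_nonlinear (n := n) hn1 (g := deriv U)
    (φ := fun t => iteratedDeriv 2 U (meanLink d ε t)) (q := meanLink d ε)
    (x := fun i t => x i t - (i : ℝ) * meanLink d ε t)
    (z := fun i t => z i t - (i : ℝ) * meanLink d ε t) (T := T) (H := A * m)
    (ρ := E * (A * m) ^ 2) hl hC hHpos (by nlinarith) (by rw [hE]; ring) (by nlinarith)
    (by
      intro t ht u hu
      rw [iteratedDeriv_two_eq]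
      exact hT _ (meanLink_mem_Icc hd0 hε ht) u hu)
    (fun t ht => hlφ _ (meanLink_mem_Icc hd0 hε ht))
    (by
      intro i hi
      have h1 := (hz.1 (i + 1) (by omega)).sub (hx.1 (i + 1) (by omega))
      exact (h1.mono fun t ht => ht.1).congr fun t _ => by simp)
    hz0 hzn hx0 hxn
    (by
      intro i hi
      rw [hz.2.1 (i + 1) (by omega), hx.2.1 (i + 1) (by omega)])
    (by
      intro i hi t ht
      have h1 := (hz.hasDerivWithinAt_linear hU ⟨i, hi⟩ ht.1).fun_sub
        (hx.hasDerivWithinAt_nonlinear hU ⟨i, hi⟩ ht.1)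
      have h2 := h1.mono (Set.Ici_subset_Ici.2 ht.1)
      refine (h2.congr_deriv ?_).congr_of_mem (fun u _ => by simp) Set.self_mem_Ici
      simp only
      congr 1
      · push_cast; ring
      · congr 2 <;> (push_cast; ring))
    hzb
  intro t ht
  have h1 := hbound t ht
  have h2 := sum_range_sq_eq_of_zero (v := fun i => z i t - x i t) (n := n)
    (by simp [hz.2.2.1 t ht.1, hx.2.2.1 t ht.1])
    (by simp only [hd1]; rw [hz.2.2.2.1 t ht.1, hx.2.2.2.1 t ht.1, sub_self])
  rw [hd1] at h2
  simp only [sub_sub_sub_cancel_right] at h1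
  rw [h2]
  refine h1.trans (pow_le_pow_left₀ (by positivity) ?_ 2)
  have : 0 ≤ E * A * m ^ 2 := by positivity
  nlinarith

end Path

/-! ### Probability estimates and the limit. -/

/-- The probability that some driving Brownian motion oscillates too much over some unit block. -/
theorem IsIndepBrownianFamily.measure_exists_oscillation_le {Ω : Type*} [MeasurableSpace Ω]
    {P : Measure Ω} [IsProbabilityMeasure P] {n : ℕ} {B : Fin n → ℝ≥0 → Ω → ℝ}
    (hB : IsIndepBrownianFamily P B) {M : ℝ} (hM0 : 0 ≤ M)
    (hM : 2 * Real.exp (-M ^ 2 / 256) ≤ 1 / 2) (N : ℕ) :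
    P {ω | ¬ ∀ k, ∀ j < N, ∀ t ∈ Set.Icc (j : ℝ) (j + 1),
        |B k t.toNNReal ω - B k j ω| ≤ M} ≤
      ENNReal.ofReal (n * N * (4 * Real.exp (-M ^ 2 / 32))) := by
  set A : Fin n → ℕ → Set Ω := fun k j => {ω | ¬ ∀ s ∈ Set.Icc (0 : ℝ) 1,
    |(B k (j + s.toNNReal) ω - B k j ω) - (B k (j + 0) ω - B k j ω)| ≤ M}
  have hA : ∀ k j, P (A k j) ≤ ENNReal.ofReal (4 * Real.exp (-M ^ 2 / 32)) := fun k j =>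
    ((hB.isBrownian k).shift (j : ℝ≥0)).measure_exists_gt_le hM0 hM
  have hsub : {ω | ¬ ∀ k, ∀ j < N, ∀ t ∈ Set.Icc (j : ℝ) (j + 1),
      |B k t.toNNReal ω - B k j ω| ≤ M} ⊆
      ⋃ k ∈ Finset.univ, ⋃ j ∈ Finset.range N, A k j := by
    intro ω hω
    by_contra hcon
    simp only [Set.mem_iUnion, not_exists, Finset.mem_range] at hcon
    refine hω fun k j hj t ht => ?_
    have h := not_not.1 (hcon k (Finset.mem_univ k) j hj) (t - j)
      ⟨by linarith [ht.1], by linarith [ht.2]⟩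
    have ht' : (j : ℝ≥0) + (t - j).toNNReal = t.toNNReal := by
      rw [← Real.toNNReal_natCast, ← Real.toNNReal_add (Nat.cast_nonneg j) (by linarith [ht.1]),
        add_sub_cancel]
    rw [ht', add_zero, sub_self, sub_zero] at h
    exact h
  refine (measure_mono hsub).trans ((measure_biUnion_finset_le _ _).trans ?_)
  have h1 : ∀ k ∈ (Finset.univ : Finset (Fin n)), P (⋃ j ∈ Finset.range N, A k j) ≤
      ENNReal.ofReal (N * (4 * Real.exp (-M ^ 2 / 32))) := by
    intro k _
    refine (measure_biUnion_finset_le _ _).trans ((Finset.sum_le_sum fun j _ => hA k j).trans ?_)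
    rw [Finset.sum_const, Finset.card_range, nsmul_eq_mul, ← ENNReal.ofReal_natCast,
      ← ENNReal.ofReal_mul (Nat.cast_nonneg N)]
  refine (Finset.sum_le_sum h1).trans ?_
  rw [Finset.sum_const, Finset.card_univ, Fintype.card_fin, nsmul_eq_mul, ← ENNReal.ofReal_natCast,
    ← ENNReal.ofReal_mul (Nat.cast_nonneg n), mul_assoc]

/-- Non-asymptotic form of the result: off the oscillation event and two null sets, the pathwise
bound `K * m ^ 2` lies strictly below the threshold. -/
theorem measure_deltaThreshold_le_SStar_le {d : ℕ} {b : ℝ} (hb : 1 < b) {U : ℝ → ℝ}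
    {θ K ε σ : ℝ}
    (hKpath : ∀ (ε σ m : ℝ) (β : Fin (d - 1) → ℝ≥0 → ℝ) (x z : ℕ → ℝ → ℝ),
      0 < ε → ε ≤ m → K * m ≤ 1 →
      IsPulledChainPath d ε σ β (nonlinearDrift U) x →
      IsPulledChainPath d ε σ β (linearDrift U d ε) z →
      (∀ k, ∀ j : ℕ, (j : ℝ) ≤ tStar d b ε → ∀ t ∈ Set.Icc (j : ℝ) (j + 1),
        |σ * (β k t.toNNReal - β k j)| ≤ m) →
      ∀ t ∈ Set.Icc 0 (tStar d b ε),
        ∑ i ∈ Finset.range (d + 1), (z i t - x i t) ^ 2 ≤ (K * m ^ 2) ^ 2)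
    (hK : 0 < K) (hε : 0 < ε) (hσ : 0 < σ) (hσ1 : σ ≤ 1) (hratio : 2 ≤ σ / ε)
    (hlog : 4 * Real.log 4 ≤ -Real.log ε)
    (hs1 : 81 * K * √(σ ^ 2 * (-Real.log ε) ^ 3) < θ)
    (hs2 : 9 * K * √(σ ^ 2 * (-Real.log ε) ^ 3) ≤ 1)
    {Ω : Type*} [MeasurableSpace Ω] {P : Measure Ω} [IsProbabilityMeasure P]
    {B : Fin (d - 1) → ℝ≥0 → Ω → ℝ} (hB : IsIndepBrownianFamily P B) {X Z : ℕ → ℝ → Ω → ℝ}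
    (hX : SolvesPulledChain P d ε σ B (nonlinearDrift U) X)
    (hZ : SolvesPulledChain P d ε σ B (linearDrift U d ε) Z) :
    P {ω | ENNReal.ofReal (deltaThreshold θ ε σ) ≤ SStar d Z X (tStar d b ε) ω} ≤
      ENNReal.ofReal ((d - 1 : ℕ) * (4 * (d * (b - 1) * ε + ε ^ 2))) := by
  set L := -Real.log ε with hL
  have hL1 : 1 ≤ L := by
    have h4 : Real.log 4 = 2 * Real.log 2 := by
      rw [show (4 : ℝ) = 2 ^ 2 by norm_num, Real.log_pow]; norm_num
    have := Real.log_two_gt_d9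
    linarith
  have hL0 : 0 < L := by linarith
  have hsL1 : 1 ≤ √L := Real.one_le_sqrt.2 hL1
  have hsqL : √L ^ 2 = L := Real.sq_sqrt hL0.le
  have hεσ : ε ≤ σ := by
    rw [le_div_iff₀ hε] at hratio; linarith
  have hs : √(σ ^ 2 * L ^ 3) = σ * (L * √L) := by
    rw [show σ ^ 2 * L ^ 3 = (σ * (L * √L)) ^ 2 by
      rw [mul_pow, mul_pow, hsqL]; ring]
    exact Real.sqrt_sq (by positivity)
  rw [hs] at hs1 hs2
  have hεexp : Real.exp (-L) = ε := by rw [hL, neg_neg, Real.exp_log hε]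
  set m := 9 * (σ * √L) with hm
  have hεm : ε ≤ m := by
    have : σ ≤ σ * √L := le_mul_of_one_le_right hσ.le hsL1
    linarith
  have hKm : K * m ≤ 1 := by
    refine le_trans (le_of_eq_of_le ?_ (mul_le_mul_of_nonneg_left
      (le_mul_of_one_le_left (by positivity : 0 ≤ σ * √L) hL1) (by positivity : 0 ≤ 9 * K))) ?_
    · rw [hm]; ring
    · linarith
  have hδ : K * m ^ 2 < deltaThreshold θ ε σ := by
    -- As `σ ≤ 1`, `ln (σ / ε) ≤ L`, so it suffices that `81 * K * σ * L ^ (3/2) < θ`.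
    have hlogpos : 0 < Real.log (σ / ε) := Real.log_pos (by linarith)
    have hlogle : Real.log (σ / ε) ≤ L := by
      rw [Real.log_div hσ.ne' hε.ne']
      have := Real.log_nonpos hσ.le hσ1
      linarith
    unfold deltaThreshold
    rw [lt_div_iff₀ (Real.sqrt_pos.2 hlogpos)]
    calc K * m ^ 2 * √(Real.log (σ / ε)) ≤ K * m ^ 2 * √L := by gcongr
      _ = 81 * K * (σ * (√L ^ 2 * √L)) * σ := by rw [hm]; ring
      _ < θ * σ := by rw [hsqL]; exact mul_lt_mul_of_pos_right hs1 hσ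
  -- Chosen so that `M ^ 2 / 32 = 2 * L`, which gives `ε ^ 2` per block against about `1 / ε`
  -- blocks; moreover `σ * M ≤ m`.
  set M := 8 * √L with hM
  have hM2 : M ^ 2 = 64 * L := by rw [hM, mul_pow, hsqL]; norm_num
  have hMexp : 2 * Real.exp (-M ^ 2 / 256) ≤ 1 / 2 := by
    have h1 : Real.exp (-M ^ 2 / 256) ≤ Real.exp (-Real.log 4) := by
      rw [hM2]; gcongr; linarith
    rw [Real.exp_neg, Real.exp_log (by norm_num)] at h1
    linarith
  have hMexp2 : Real.exp (-M ^ 2 / 32) = ε ^ 2 := by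
    rw [hM2, show -(64 * L) / 32 = -L + -L by ring, Real.exp_add, hεexp, sq]
  set T := tStar d b ε with hT
  have hT0 : 0 ≤ T := div_nonneg (mul_nonneg (Nat.cast_nonneg d) (by linarith)) hε.le
  have hsub : {ω | ENNReal.ofReal (deltaThreshold θ ε σ) ≤ SStar d Z X T ω} ⊆
      {ω | ¬ ∀ k, ∀ j < ⌊T⌋₊ + 1, ∀ t ∈ Set.Icc (j : ℝ) (j + 1),
        |B k t.toNNReal ω - B k j ω| ≤ M} ∪
      ({ω | ¬ IsPulledChainPath d ε σ (fun k t => B k t ω) (nonlinearDrift U)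
          (fun i t => X i t ω)} ∪
        {ω | ¬ IsPulledChainPath d ε σ (fun k t => B k t ω) (linearDrift U d ε)
          (fun i t => Z i t ω)}) := by
    intro ω hω
    by_contra hcon
    simp only [Set.mem_union, not_or] at hcon
    have h1 := not_not.1 hcon.1
    have hb := hKpath ε σ m (fun k t => B k t ω) _ _ hε hεm hKm (not_not.1 hcon.2.1)
      (not_not.1 hcon.2.2) (by
        intro k j hj t ht
        have h2 := h1 k j (Nat.lt_succ_of_le (Nat.le_floor hj)) t ht
        rw [abs_mul, abs_of_pos hσ]
        calc σ * |B k t.toNNReal ω - B k j ω| ≤ σ * M := by gcongr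
          _ ≤ m := by
            have : 0 ≤ σ * √L := by positivity
            rw [hM, hm]; linarith)
    have hle : SStar d Z X T ω ≤ ENNReal.ofReal (K * m ^ 2) :=
      iSup₂_le fun t ht => ENNReal.ofReal_le_ofReal
        ((Real.sqrt_le_left (by positivity)).2 (hb t ht))
    have hlt : ENNReal.ofReal (K * m ^ 2) < ENNReal.ofReal (deltaThreshold θ ε σ) :=
      (ENNReal.ofReal_lt_ofReal_iff_of_nonneg (by positivity)).2 hδ
    exact absurd (show ENNReal.ofReal (deltaThreshold θ ε σ) ≤ SStar d Z X T ω from hω)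
      (not_le.2 (hle.trans_lt hlt))
  have hX0 : P {ω | ¬ IsPulledChainPath d ε σ (fun k t => B k t ω) (nonlinearDrift U)
      (fun i t => X i t ω)} = 0 := hX
  have hZ0 : P {ω | ¬ IsPulledChainPath d ε σ (fun k t => B k t ω) (linearDrift U d ε)
      (fun i t => Z i t ω)} = 0 := hZ
  refine (measure_mono hsub).trans ((measure_union_le _ _).trans ?_)
  rw [measure_union_null hX0 hZ0, add_zero]
  refine (hB.measure_exists_oscillation_le (by positivity) hMexp _).trans
    (ENNReal.ofReal_le_ofReal ?_)
  rw [hMexp2, mul_assoc]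
  refine mul_le_mul_of_nonneg_left ?_ (Nat.cast_nonneg _)
  push_cast
  calc ((⌊T⌋₊ : ℝ) + 1) * (4 * ε ^ 2) ≤ (T + 1) * (4 * ε ^ 2) := by
        gcongr; exact Nat.floor_le hT0
    _ = _ := by rw [hT, tStar]; field_simp

theorem mainTheorem5
    (d : ℕ) (hd : 2 ≤ d) (b : ℝ) (hb : 1 < b) (U : ℝ → ℝ) (hU : AssumptionP U b)
    (θ : ℝ) (hθ : 0 < θ)
    {ι : Type*} (l : Filter ι) (ε σ : ι → ℝ)
    (hε : Tendsto ε l (𝓝[>] 0)) (hσ : Tendsto σ l (𝓝[>] 0))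
    (hratio : Tendsto (fun j => σ j / ε j) l atTop)
    (hlog : Tendsto (fun j => (σ j) ^ 2 * |Real.log (ε j)| ^ 3) l (𝓝 0))
    (Ω : ι → Type*) [∀ j, MeasurableSpace (Ω j)]
    (P : ∀ j, Measure (Ω j)) [∀ j, IsProbabilityMeasure (P j)]
    (B : ∀ j, Fin (d - 1) → ℝ≥0 → Ω j → ℝ) (hB : ∀ j, IsIndepBrownianFamily (P j) (B j))
    (X Z : ∀ j, ℕ → ℝ → Ω j → ℝ)
    (hX : ∀ j, SolvesPulledChain (P j) d (ε j) (σ j) (B j) (nonlinearDrift U) (X j))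
    (hZ : ∀ j, SolvesPulledChain (P j) d (ε j) (σ j) (B j) (linearDrift U d (ε j)) (Z j)) :
    Tendsto
      (fun j => P j {ω | ENNReal.ofReal (deltaThreshold θ (ε j) (σ j)) ≤
        SStar d (Z j) (X j) (tStar d b (ε j)) ω})
      l (𝓝 0) := by
  obtain ⟨K, hK, hpath⟩ := exists_pathwise_bound hd hb hU
  have hε0 : Tendsto ε l (𝓝 0) := hε.mono_right nhdsWithin_le_nhds
  have hσ0 : Tendsto σ l (𝓝 0) := hσ.mono_right nhdsWithin_le_nhds
  have hεpos : ∀ᶠ j in l, 0 < ε j := hε.eventually self_mem_nhdsWithin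
  have hσpos : ∀ᶠ j in l, 0 < σ j := hσ.eventually self_mem_nhdsWithin
  have hlogε : Tendsto (fun j => -Real.log (ε j)) l atTop :=
    tendsto_neg_atBot_atTop.comp (Real.tendsto_log_nhdsGT_zero.comp hε)
  have hs : Tendsto (fun j => √((σ j) ^ 2 * |Real.log (ε j)| ^ 3)) l (𝓝 0) := by
    have h := (Real.continuous_sqrt.tendsto 0).comp hlog
    rw [Real.sqrt_zero] at h
    exact h
  have hs1 : ∀ᶠ j in l, 81 * K * √((σ j) ^ 2 * |Real.log (ε j)| ^ 3) < θ :=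
    (by simpa using hs.const_mul (81 * K) :
      Tendsto (fun j => 81 * K * √((σ j) ^ 2 * |Real.log (ε j)| ^ 3)) l (𝓝 0)).eventually_lt_const
      hθ
  have hs2 : ∀ᶠ j in l, 9 * K * √((σ j) ^ 2 * |Real.log (ε j)| ^ 3) < 1 :=
    (by simpa using hs.const_mul (9 * K) :
      Tendsto (fun j => 9 * K * √((σ j) ^ 2 * |Real.log (ε j)| ^ 3)) l (𝓝 0)).eventually_lt_const
      one_pos
  have hbound : Tendsto (fun j => ENNReal.ofReal
      ((d - 1 : ℕ) * (4 * (d * (b - 1) * ε j + ε j ^ 2)))) l (𝓝 0) := by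
    have h := ((((hε0.const_mul (d * (b - 1))).add (hε0.pow 2)).const_mul 4).const_mul
      ((d - 1 : ℕ) : ℝ))
    simpa using ENNReal.tendsto_ofReal h
  refine tendsto_of_tendsto_of_tendsto_of_le_of_le' tendsto_const_nhds hbound
    (Eventually.of_forall fun j => zero_le) ?_
  filter_upwards [hεpos, hσpos, hσ0.eventually_le_const one_pos, hratio.eventually_ge_atTop 2,
    hlogε.eventually_ge_atTop (4 * Real.log 4), hs1, hs2] with j h1 h2 h3 h4 h5 h6 h7
  have habs : |Real.log (ε j)| = -Real.log (ε j) :=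
    abs_of_nonpos (by linarith [Real.log_pos (by norm_num : (1 : ℝ) < 4)])
  rw [habs] at h6 h7
  exact measure_deltaThreshold_le_SStar_le hb hpath hK h1 h2 h3 h4 h5 h6 h7.le (hB j) (hX j) (hZ j)
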